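/- Let $(M,d)$ be a metric space. For subsets $X,Y\subseteq M$ and $\alpha>0$, let $\mathscr{C}_Y(X,\alpha)$ be the (generalized) Čech complex: the abstract simplicial complex whose simplices are the nonempty finite subsets $\sigma\subseteq X$ for which there is $y\in Y$ with $d(x,y)<\alpha$ for all $x\in\sigma$. Write $|K|$ for the geometric realization (with the weak topology) of an abstract simplicial complex $K$; for $X\subseteq X'$ and $Y\subseteq Y'$ the inclusion $\mathscr{C}_Y(X,\alpha)\subseteq\mathscr{C}_{Y'}(X',\alpha)$ induces a continuous map $|\mathscr{C}_Y(X,\alpha)|\hookrightarrow|\mathscr{C}_{Y'}(X',\alpha)|$. If $A\subseteq X\subseteq M$, then for every $\alpha>0$ there are homotopy equivalences $$\Gamma_1:|\mathscr{C}_X(A,\alpha)|\to|\mathscr{C}_A(X,\alpha)|,\qquad \Gamma_2:|\mathscr{C}_M(A,\alpha)|\to|\mathscr{C}_A(M,\alpha)|,\qquad \Gamma_3:|\mathscr{C}_M(X,\alpha)|\to|\mathscr{C}_X(M,\alpha)|$$ such that both squares of the diagram $$\begin{array}{ccccc} |\mathscr{C}_X(A,\alpha)| & \hookrightarrow & |\mathscr{C}_M(A,\alpha)|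 & \hookrightarrow & |\mathscr{C}_M(X,\alpha)|\\ {\scriptstyle\Gamma_1}\downarrow & & {\scriptstyle\Gamma_2}\downarrow & & \downarrow{\scriptstyle\Gamma_3}\\ |\mathscr{C}_A(X,\alpha)| & \hookrightarrow & |\mathscr{C}_A(M,\alpha)| & \hookrightarrow & |\mathscr{C}_X(M,\alpha)| \end{array}$$ whose horizontal maps are induced by the inclusions, commute up to homotopy. -/

import Mathlib

/-- The geometric realization `|K|` of an abstract simplicial complex `K` in barycentric
coordinates: finitely supported nonnegative weights on the vertices with total mass `1`, whose
support is a simplex of `K`. -/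
@[ext]
structure Realization {V : Type*} (K : PreAbstractSimplicialComplex V) where
  weight : V →₀ ℝ
  nonneg : ∀ v, 0 ≤ weight v
  support_mem : weight.support ∈ K.faces
  sum_eq_one : (weight.sum fun _ a => a) = 1

namespace Realization

variable {V : Type*}

/-- The closed simplex spanned by a face `s` of `K`, as a map from the standard simplex with
vertex set `s` to `|K|` (extension of barycentric coordinates by zero). -/
noncomputable def simplexMap (K : PreAbstractSimplicialComplex V) (s : K.faces)
    (x : stdSimplex ℝ (s : Finset V)) : Realization K where
  weight := Finsupp.embDomain (Function.Embedding.subtype _)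
    (Finsupp.equivFunOnFinite.symm x.1)
  nonneg v := by
    by_cases hv : v ∈ (s : Finset V)
    · have h := Finsupp.embDomain_apply_self (Function.Embedding.subtype (· ∈ (s : Finset V)))
        (Finsupp.equivFunOnFinite.symm x.1) ⟨v, hv⟩
      simp only [Function.Embedding.coe_subtype] at h
      rw [h]
      exact x.2.1 _
    · rw [Finsupp.embDomain_of_notMem_range]
      rintro ⟨w, rfl⟩
      exact hv w.2
  support_mem := by
    refine (K.isRelLowerSet_faces s.2).2 ?_ ?_
    · intro v hv
      rw [Finsupp.support_embDomain, Finset.mem_map] at hv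
      obtain ⟨w, -, rfl⟩ := hv
      exact w.2
    · rw [Finsupp.support_embDomain, Finset.map_nonempty, Finsupp.support_nonempty_iff]
      intro h
      have h0 : x.1 = 0 := funext fun v => DFunLike.congr_fun h v
      have h1 := x.2.2
      rw [h0] at h1
      simp at h1
  sum_eq_one := by
    rw [Finsupp.sum_embDomain, Finsupp.sum_fintype _ _ (fun _ => rfl)]
    exact x.2.2

/-- The weak (coherent) topology: a subset of `|K|` is open if and only if its intersection with
every closed simplex is open in that simplex. -/
noncomputable instance instTopologicalSpace (K : PreAbstractSimplicialComplex V) :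
    TopologicalSpace (Realization K) :=
  ⨆ s : K.faces, TopologicalSpace.coinduced (simplexMap K s) inferInstance

theorem continuous_simplexMap (K : PreAbstractSimplicialComplex V) (s : K.faces) :
    Continuous (simplexMap K s) :=
  continuous_iff_coinduced_le.2
    (le_iSup (fun s : K.faces => TopologicalSpace.coinduced (simplexMap K s) inferInstance) s)

/-- The continuous map `|K| → |L|` induced by the inclusion of a subcomplex `K` in `L`. -/
noncomputable def incl {K L : PreAbstractSimplicialComplex V} (h : K ≤ L) :
    C(Realization K, Realization L) where
  toFun p := ⟨p.weight, p.nonneg, h p.support_mem, p.sum_eq_one⟩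
  continuous_toFun := by
    refine continuous_iSup_dom.2 fun s => continuous_coinduced_dom.2 ?_
    exact continuous_simplexMap L ⟨s.1, h s.2⟩

end Realization

/-- The (generalized) Čech complex `𝒞_Y(X, α)`: its simplices are the nonempty finite subsets `σ`
of `X` for which some `y ∈ Y` satisfies `d(x, y) < α` for all `x ∈ σ`. -/
def cechComplex {M : Type*} [MetricSpace M] (Y X : Set M) (α : ℝ) :
    PreAbstractSimplicialComplex M where
  faces := {σ | σ.Nonempty ∧ (σ : Set M) ⊆ X ∧ ∃ y ∈ Y, ∀ x ∈ σ, dist x y < α}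
  isRelLowerSet_faces := by
    rintro σ ⟨hσ, hX, y, hy, h⟩
    exact ⟨hσ, fun τ hτσ hτ =>
      ⟨hτ, fun x hx => hX (hτσ hx), y, hy, fun x hx => h x (hτσ hx)⟩⟩

theorem cechComplex_mono {M : Type*} [MetricSpace M] {Y Y' X X' : Set M} (hY : Y ⊆ Y')
    (hX : X ⊆ X') (α : ℝ) : cechComplex Y X α ≤ cechComplex Y' X' α := by
  rintro σ ⟨hσ, hσX, y, hy, h⟩
  exact ⟨hσ, hσX.trans hX, y, hY hy, h⟩

/-!
Each vertical map is an instance of Dowker duality. For a relation `R` between `V` and `W`, let `K`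
be the complex of nonempty finite subsets of `V` all of whose members are related to one common
element of `W`, and `L` the complex obtained in the same way from the transposed relation. Then `|K|`
and `|L|` are homotopy equivalent, naturally in `R` up to homotopy. The Čech complexes of a column
arise from the relation `dist x y < α` between the points `x` of one set and `y` of another.

The equivalence is written down in barycentric coordinates, without subdivisions. For `p ∈ |K|` let
`θ = (∑ p(v)²) / 2`; some weight of `p` exceeds `θ`. The map `dowkerMap : |K| → |L|` spreads mass over
chosen witnesses of those sets `T` of vertices of `p` that carry total weight more than `1 - θ`. Such
a `T` contains every vertex with `p(v) > θ`, so all witnesses used are related to all these vertices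
(`IsDowker.rel_of_mem_support`); in particular they span a simplex of `L`.

All homotopies are straight-line homotopies between contiguous maps (`homotopic_of_union_support_mem`).
The identity of `|K|` is contiguous to `truncate`, which keeps the vertices with `p(v) > θ` only. In
turn `truncate` is contiguous to the round trip `|K| → |L| → |K|`: a vertex `w` of large weight in the
image of `p` is related to the vertices kept by `truncate` and to all vertices of the round trip
(`dowkerMap_comp_homotopic_id`). Naturality holds since, for `R ⊆ R'`, a vertex of `p` of large weight
is `R'`-related to the witnesses for `R` and to those for `R'` (`dowkerMap_comp_incl_homotopic`).

Continuity is checked on closed simplices, where only finitely many vertices of the target occur;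
then it is enough that each barycentric coordinate is continuous (`continuous_of_continuous_weight`).
-/

namespace Realization

/-! ### Continuity and homotopies in the weak topology -/

section Topology

variable {V W Z : Type*} {K : PreAbstractSimplicialComplex V} {L : PreAbstractSimplicialComplex W}

theorem simplexMap_weight_coe (s : K.faces) (x : stdSimplex ℝ (s : Finset V)) (v : (s : Finset V)) :
    (simplexMap K s x).weight v = x.1 v :=
  Finsupp.embDomain_apply_self (Function.Embedding.subtype (· ∈ (s : Finset V)))
    (Finsupp.equivFunOnFinite.symm x.1) v

theorem simplexMap_weight_of_notMem (s : K.faces) (x : stdSimplex ℝ (s : Finset V)) {v : V}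
    (hv : v ∉ (s : Finset V)) : (simplexMap K s x).weight v = 0 := by
  refine Finsupp.embDomain_of_notMem_range _ _ _ ?_
  rintro ⟨w, rfl⟩
  exact hv w.2

theorem support_simplexMap_subset (s : K.faces) (x : stdSimplex ℝ (s : Finset V)) :
    (simplexMap K s x).weight.support ⊆ s := by
  intro v hv
  by_contra h
  exact Finsupp.mem_support_iff.1 hv (simplexMap_weight_of_notMem s x h)

theorem continuous_simplexMap_weight (s : K.faces) (v : V) :
    Continuous fun x => (simplexMap K s x).weight v := by
  by_cases hv : v ∈ (s : Finset V)
  · have h : (fun x => (simplexMap K s x).weight v) = fun x => x.1 ⟨v, hv⟩ :=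
      funext fun x => simplexMap_weight_coe s x ⟨v, hv⟩
    rw [h]
    exact (continuous_apply _).comp continuous_subtype_val
  · simp only [simplexMap_weight_of_notMem s _ hv]
    exact continuous_const

theorem continuous_iff_simplexMap [TopologicalSpace Z] {f : Realization K → Z} :
    Continuous f ↔ ∀ s, Continuous fun x => f (simplexMap K s x) :=
  ⟨fun h s => h.comp (continuous_simplexMap K s),
    fun h => continuous_iSup_dom.2 fun s => continuous_coinduced_dom.2 (h s)⟩

theorem continuous_weight (v : V) : Continuous fun p : Realization K => p.weight v :=
  continuous_iff_simplexMap.2 fun s => continuous_simplexMap_weight s v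

theorem sum_weight {p : Realization K} {s : Finset V} (h : p.weight.support ⊆ s) :
    ∑ v ∈ s, p.weight v = 1 := by
  rw [← p.sum_eq_one, Finsupp.sum_of_support_subset _ h _ fun _ _ => rfl]

/-- The barycentric coordinates, with respect to a face `s`, of a point supported in `s`. -/
def toStdSimplex (p : Realization K) {s : Finset V} (h : p.weight.support ⊆ s) :
    stdSimplex ℝ s :=
  ⟨fun v => p.weight v, fun v => p.nonneg v, by
    rw [Finset.sum_coe_sort s fun v => p.weight v]
    exact sum_weight h⟩

theorem simplexMap_toStdSimplex (p : Realization K) (s : K.faces)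
    (h : p.weight.support ⊆ s) : simplexMap K s (p.toStdSimplex h) = p := by
  ext v
  by_cases hv : v ∈ (s : Finset V)
  · exact simplexMap_weight_coe s _ ⟨v, hv⟩
  · rw [simplexMap_weight_of_notMem s _ hv]
    exact (Finsupp.notMem_support_iff.1 fun hp => hv (h hp)).symm

/-- A map into a realization that meets only finitely many vertices is continuous as soon as its
barycentric coordinates are: the preimages of the finitely many closed simplices involved form a
finite closed cover of the source. -/
theorem continuous_of_continuous_weight [TopologicalSpace Z] {f : Z → Realization L}
    (F : Finset W) (hF : ∀ z, (f z).weight.support ⊆ F)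
    (hf : ∀ w, Continuous fun z => (f z).weight w) : Continuous f := by
  let A : {τ : L.faces // (τ : Finset W) ∈ F.powerset} → Set Z :=
    fun τ => {z | (f z).weight.support ⊆ τ.1.1}
  have hfin : Finite {τ : L.faces // (τ : Finset W) ∈ F.powerset} :=
    Finite.of_injective (fun τ => (⟨τ.1.1, τ.2⟩ : F.powerset)) fun a b h =>
      Subtype.ext (Subtype.ext (by simpa using h))
  refine (locallyFinite_of_finite A).continuous ?_ ?_ ?_
  · refine Set.eq_univ_of_forall fun z => Set.mem_iUnion.2
      ⟨⟨⟨_, (f z).support_mem⟩, Finset.mem_powerset.2 (hF z)⟩, ?_⟩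
    exact Finset.Subset.refl _
  · intro τ
    have h : A τ = ⋂ w, ⋂ (_ : w ∉ τ.1.1), {z | (f z).weight w = 0} := by
      ext z
      simp only [A, Set.mem_ofPred_eq, Set.mem_iInter, Finset.subset_iff, Finsupp.mem_support_iff]
      exact forall_congr' fun w => not_imp_comm
    rw [h]
    exact isClosed_iInter fun w => isClosed_iInter fun _ => isClosed_eq (hf w) continuous_const
  · intro τ
    rw [continuousOn_iff_continuous_domRestrict]
    have h : (A τ).domRestrict f = fun z : A τ => simplexMap L τ.1 ((f z).toStdSimplex z.2) :=
      funext fun z => (simplexMap_toStdSimplex _ _ _).symm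
    rw [h]
    refine (continuous_simplexMap L τ.1).comp (Continuous.subtype_mk ?_ _)
    exact continuous_pi fun w => (hf w).comp continuous_subtype_val

/-- The product of `|K|` with a locally compact space still carries the topology coherent with the
closed simplices; this is seen by currying. -/
theorem continuous_prod_of_simplexMap {T : Type*} [TopologicalSpace T] [LocallyCompactSpace T]
    [TopologicalSpace Z] {f : T × Realization K → Z}
    (hf : ∀ s : K.faces,
      Continuous fun y : stdSimplex ℝ (s : Finset V) × T => f (y.2, simplexMap K s y.1)) :
    Continuous f := by
  have hp (p : Realization K) : Continuous fun t => f (t, p) := by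
    have h := (hf ⟨p.weight.support, p.support_mem⟩).comp
      (Continuous.prodMk_right (p.toStdSimplex (Finset.Subset.refl _)))
    simpa only [Function.comp_def, simplexMap_toStdSimplex] using h
  let G : Realization K → C(T, Z) := fun p => ⟨fun t => f (t, p), hp p⟩
  have hG : Continuous G := continuous_iff_simplexMap.2 fun s =>
    ContinuousMap.continuous_of_continuous_uncurry _ (hf s)
  exact (ContinuousMap.continuous_uncurry_of_continuous ⟨G, hG⟩).comp
    (continuous_snd.prodMk continuous_fst)

/-- A map of realizations is finitely carried if it sends the points supported in a finite vertex
set to points supported in a finite vertex set. -/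
def FinitelyCarried (f : Realization K → Realization L) : Prop :=
  ∀ F : Finset V, ∃ G : Finset W, ∀ p, p.weight.support ⊆ F → (f p).weight.support ⊆ G

theorem FinitelyCarried.comp {U : Type*} {J : PreAbstractSimplicialComplex U}
    {g : Realization L → Realization J} {f : Realization K → Realization L}
    (hg : FinitelyCarried g) (hf : FinitelyCarried f) : FinitelyCarried (g ∘ f) := by
  intro F
  obtain ⟨G, hG⟩ := hf F
  obtain ⟨H, hH⟩ := hg G
  exact ⟨H, fun p hp => hH _ (hG p hp)⟩

theorem finitelyCarried_id : FinitelyCarried (id : Realization K → Realization K) :=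
  fun F => ⟨F, fun _ h => h⟩

theorem finitelyCarried_incl {K' : PreAbstractSimplicialComplex V} (h : K ≤ K') :
    FinitelyCarried (incl h) :=
  fun F => ⟨F, fun _ h => h⟩

/-- The point of `|L|` with barycentric coordinates proportional to given nonnegative weights. -/
noncomputable def normalize (u : W →₀ ℝ) (h0 : ∀ w, 0 ≤ u w) (hu : u.support ∈ L.faces) :
    Realization L :=
  have hpos : 0 < ∑ w ∈ u.support, u w :=
    Finset.sum_pos (fun w hw => (h0 w).lt_of_ne' (Finsupp.mem_support_iff.1 hw))
      (L.isRelLowerSet_faces hu).1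
  { weight := (∑ w ∈ u.support, u w)⁻¹ • u
    nonneg := fun w => mul_nonneg (inv_nonneg.2 hpos.le) (h0 w)
    support_mem := by rwa [Finsupp.support_smul_eq (inv_ne_zero hpos.ne')]
    sum_eq_one := by
      rw [Finsupp.sum, Finsupp.support_smul_eq (inv_ne_zero hpos.ne')]
      simp only [Finsupp.smul_apply, smul_eq_mul]
      rw [← Finset.mul_sum, inv_mul_cancel₀ hpos.ne'] }

theorem support_normalize (u : W →₀ ℝ) (h0 : ∀ w, 0 ≤ u w) (hu : u.support ∈ L.faces) :
    (normalize u h0 hu).weight.support = u.support := by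
  refine Finset.Subset.antisymm Finsupp.support_smul fun w hw => ?_
  have hpos : 0 < ∑ w ∈ u.support, u w :=
    Finset.sum_pos (fun w hw => (h0 w).lt_of_ne' (Finsupp.mem_support_iff.1 hw))
      (L.isRelLowerSet_faces hu).1
  exact Finsupp.mem_support_iff.2
    (mul_ne_zero (inv_ne_zero hpos.ne') (Finsupp.mem_support_iff.1 hw))

theorem continuous_normalize {u : Realization K → W →₀ ℝ} {h0 : ∀ p w, 0 ≤ u p w}
    {hu : ∀ p, (u p).support ∈ L.faces}
    (hF : ∀ F : Finset V, ∃ G : Finset W, ∀ p, p.weight.support ⊆ F → (u p).support ⊆ G)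
    (hc : ∀ s w, Continuous fun x => u (simplexMap K s x) w) :
    Continuous fun p => normalize (u p) (h0 p) (hu p) := by
  refine continuous_iff_simplexMap.2 fun s => ?_
  obtain ⟨G, hG⟩ := hF s
  replace hG := fun x => hG (simplexMap K s x) (support_simplexMap_subset s x)
  refine continuous_of_continuous_weight G (fun x => ?_) fun w => ?_
  · rw [support_normalize]
    exact hG x
  · have hsum (x) : ∑ w ∈ (u (simplexMap K s x)).support, u (simplexMap K s x) w
        = ∑ w ∈ G, u (simplexMap K s x) w :=
      Finset.sum_subset (hG x) fun w _ hw => Finsupp.notMem_support_iff.1 hw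
    refine Continuous.mul (Continuous.inv₀ ?_ fun x => ?_) (hc s w)
    · simp only [hsum]
      exact continuous_finsetSum _ fun w _ => hc s w
    · exact (Finset.sum_pos (fun w hw => (h0 _ w).lt_of_ne' (Finsupp.mem_support_iff.1 hw))
        (L.isRelLowerSet_faces (hu _)).1).ne'

theorem support_lineMap_subset [DecidableEq W] (p q : Realization L) (t : unitInterval) :
    ((1 - t.1) • p.weight + t.1 • q.weight).support ⊆ p.weight.support ∪ q.weight.support :=
  Finsupp.support_add.trans (Finset.union_subset_union Finsupp.support_smul Finsupp.support_smul)

theorem sum_lineMap [DecidableEq W] (p q : Realization L) (t : unitInterval) :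
    ∑ w ∈ p.weight.support ∪ q.weight.support, ((1 - t.1) • p.weight + t.1 • q.weight) w = 1 := by
  simp only [Finsupp.add_apply, Finsupp.smul_apply, smul_eq_mul]
  rw [Finset.sum_add_distrib, ← Finset.mul_sum, ← Finset.mul_sum,
    sum_weight Finset.subset_union_left, sum_weight Finset.subset_union_right]
  ring

/-- The point dividing the segment from `p` to `q` in the ratio `t : 1 - t`, inside a simplex
that contains both. -/
noncomputable def lineMap [DecidableEq W] (p q : Realization L)
    (h : p.weight.support ∪ q.weight.support ∈ L.faces) (t : unitInterval) : Realization L where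
  weight := (1 - t.1) • p.weight + t.1 • q.weight
  nonneg w := add_nonneg (mul_nonneg (sub_nonneg.2 t.2.2) (p.nonneg w))
    (mul_nonneg t.2.1 (q.nonneg w))
  support_mem := by
    refine (L.isRelLowerSet_faces h).2 (support_lineMap_subset p q t) ?_
    rw [Finset.nonempty_iff_ne_empty]
    intro h0
    rw [Finsupp.support_eq_empty] at h0
    have h1 := sum_lineMap p q t
    rw [h0] at h1
    simp at h1
  sum_eq_one := by
    rw [Finsupp.sum_of_support_subset _ (support_lineMap_subset p q t) _ fun _ _ => rfl]
    exact sum_lineMap p q t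

/-- Contiguous maps are homotopic: if `f p` and `g p` always lie in a common closed simplex, then
the straight-line homotopy between them is continuous. -/
theorem homotopic_of_union_support_mem [DecidableEq W] {f g : C(Realization K, Realization L)}
    (hf : FinitelyCarried f) (hg : FinitelyCarried g)
    (h : ∀ p, (f p).weight.support ∪ (g p).weight.support ∈ L.faces) : f.Homotopic g := by
  have hcont : Continuous fun y : unitInterval × Realization K =>
      lineMap (f y.2) (g y.2) (h y.2) y.1 := by
    refine continuous_prod_of_simplexMap fun s => ?_
    obtain ⟨F, hF⟩ := hf s
    obtain ⟨G, hG⟩ := hg s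
    refine continuous_of_continuous_weight (F ∪ G) (fun y => ?_) fun w => ?_
    · have hy := support_simplexMap_subset s y.1
      exact (support_lineMap_subset (f (simplexMap K s y.1)) (g (simplexMap K s y.1)) y.2).trans
        (Finset.union_subset_union (hF _ hy) (hG _ hy))
    · have hs : Continuous fun y : stdSimplex ℝ (s : Finset V) × unitInterval =>
          simplexMap K s y.1 := (continuous_simplexMap K s).comp continuous_fst
      have ht : Continuous fun y : stdSimplex ℝ (s : Finset V) × unitInterval => (y.2 : ℝ) :=
        continuous_subtype_val.comp continuous_snd
      exact ((continuous_const.sub ht).mul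
          ((continuous_weight w).comp (f.continuous.comp hs))).add
        (ht.mul ((continuous_weight w).comp (g.continuous.comp hs)))
  exact ⟨{
    toContinuousMap := ⟨_, hcont⟩
    map_zero_left := fun p => by
      ext w
      simp [lineMap]
    map_one_left := fun p => by
      ext w
      simp [lineMap] }⟩

end Topology

/-! ### Dowker duality -/

section Dowker

variable {V W : Type*} {K K' : PreAbstractSimplicialComplex V}
  {L L' : PreAbstractSimplicialComplex W} {R R' : V → W → Prop}

/-- `K` is the Dowker complex of the relation `R`: its simplices are the nonempty finite sets of
vertices that are all related to one common element. Being a property of `K`, it lets `K` keep its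
given form instead of being replaced by a complex constructed from `R`. -/
def IsDowker (R : V → W → Prop) (K : PreAbstractSimplicialComplex V) : Prop :=
  ∀ σ : Finset V, σ ∈ K.faces ↔ σ.Nonempty ∧ ∃ w, ∀ v ∈ σ, R v w

theorem IsDowker.flip_flip (hK : IsDowker R K) : IsDowker (flip (flip R)) K := hK

/-- Half the sum of the squared weights of `p`: a positive threshold, depending continuously on `p`
over each simplex, that is always exceeded by the largest weight. -/
noncomputable def threshold (p : Realization K) : ℝ := (p.weight.sum fun _ a => a ^ 2) / 2

theorem threshold_eq (p : Realization K) {s : Finset V} (h : p.weight.support ⊆ s) :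
    p.threshold = (∑ v ∈ s, p.weight v ^ 2) / 2 := by
  rw [threshold, Finsupp.sum_of_support_subset _ h _ fun _ _ => by norm_num]

theorem sum_sq_pos (p : Realization K) : 0 < ∑ v ∈ p.weight.support, p.weight v ^ 2 :=
  Finset.sum_pos (fun v hv => pow_pos ((p.nonneg v).lt_of_ne' (Finsupp.mem_support_iff.1 hv)) 2)
    (K.isRelLowerSet_faces p.support_mem).1

theorem threshold_pos (p : Realization K) : 0 < p.threshold := by
  rw [threshold_eq p (Finset.Subset.refl _)]
  exact half_pos p.sum_sq_pos

theorem exists_threshold_lt (p : Realization K) : ∃ v, p.threshold < p.weight v := by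
  by_contra! h
  -- If no weight exceeded the threshold, the sum of squares would be at most half of itself.
  have h1 : ∑ v ∈ p.weight.support, p.weight v ^ 2
      ≤ ∑ v ∈ p.weight.support, p.threshold * p.weight v :=
    Finset.sum_le_sum fun v _ => by
      rw [sq]
      exact mul_le_mul_of_nonneg_right (h v) (p.nonneg v)
  rw [← Finset.mul_sum, sum_weight (Finset.Subset.refl _), mul_one,
    threshold_eq p (Finset.Subset.refl _)] at h1
  linarith [p.sum_sq_pos]

theorem mem_support_of_threshold_lt {p : Realization K} {v : V} (h : p.threshold < p.weight v) :
    v ∈ p.weight.support :=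
  Finsupp.mem_support_iff.2 (p.threshold_pos.trans h).ne'

theorem continuous_threshold_simplexMap (s : K.faces) :
    Continuous fun x => (simplexMap K s x).threshold := by
  simp only [fun x => threshold_eq (simplexMap K s x) (support_simplexMap_subset s x)]
  exact (continuous_finsetSum _ fun v _ => (continuous_simplexMap_weight s v).pow 2).div_const 2

/-- The excess of the weights of `p` over its threshold, cut off at zero. -/
noncomputable def excess (p : Realization K) : V →₀ ℝ :=
  p.weight.mapRange (fun a => max (a - p.threshold) 0)
    (max_eq_right (by linarith [p.threshold_pos]))

theorem mem_support_excess {p : Realization K} {v : V} :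
    v ∈ p.excess.support ↔ p.threshold < p.weight v := by
  rw [Finsupp.mem_support_iff, excess, Finsupp.mapRange_apply, ne_eq, max_eq_right_iff, not_le,
    sub_pos]

theorem support_excess_subset (p : Realization K) : p.excess.support ⊆ p.weight.support :=
  fun _ hv => mem_support_of_threshold_lt (mem_support_excess.1 hv)

theorem support_excess_mem (p : Realization K) : p.excess.support ∈ K.faces := by
  refine (K.isRelLowerSet_faces p.support_mem).2 p.support_excess_subset ?_
  obtain ⟨v, hv⟩ := p.exists_threshold_lt
  exact ⟨v, mem_support_excess.2 hv⟩

theorem excess_nonneg (p : Realization K) (v : V) : 0 ≤ p.excess v := le_max_right _ _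

/-- The self-map of `|K|` that discards the vertices whose weight is at most the threshold. -/
noncomputable def truncate : C(Realization K, Realization K) where
  toFun p := normalize p.excess p.excess_nonneg p.support_excess_mem
  continuous_toFun := continuous_normalize
    (fun F => ⟨F, fun p hp => p.support_excess_subset.trans hp⟩) fun s v =>
      ((continuous_simplexMap_weight s v).sub (continuous_threshold_simplexMap s)).max
        continuous_const

theorem support_truncate (p : Realization K) : (truncate p).weight.support = p.excess.support :=
  support_normalize p.excess p.excess_nonneg p.support_excess_mem

theorem finitelyCarried_truncate :
    FinitelyCarried (truncate : Realization K → Realization K) := fun F =>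
  ⟨F, fun p hp => by
    rw [support_truncate]
    exact p.support_excess_subset.trans hp⟩

theorem homotopic_id_truncate :
    (ContinuousMap.id (Realization K)).Homotopic truncate := by
  classical
  refine homotopic_of_union_support_mem finitelyCarried_id finitelyCarried_truncate fun p => ?_
  rw [support_truncate, ContinuousMap.id_apply, Finset.union_eq_left.2 (p.support_excess_subset)]
  exact p.support_mem

/-- The coefficient of a vertex set `T` in the definition of the Dowker map. For `T` inside the
support of `p` it is positive exactly if the total weight outside `T` is below the threshold, so
that `T` contains every vertex whose weight exceeds the threshold. -/
noncomputable def coeff (p : Realization K) (T : Finset V) : ℝ :=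
  (∏ v ∈ T, p.weight v) * max (p.threshold - (1 - ∑ v ∈ T, p.weight v)) 0

theorem coeff_nonneg (p : Realization K) (T : Finset V) : 0 ≤ p.coeff T :=
  mul_nonneg (Finset.prod_nonneg fun v _ => p.nonneg v) (le_max_right _ _)

theorem coeff_support_pos (p : Realization K) : 0 < p.coeff p.weight.support := by
  refine mul_pos (Finset.prod_pos fun v hv =>
    (p.nonneg v).lt_of_ne' (Finsupp.mem_support_iff.1 hv)) (lt_max_of_lt_left ?_)
  rw [sum_weight (Finset.Subset.refl _)]
  linarith [p.threshold_pos]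

theorem subset_support_of_coeff_ne_zero {p : Realization K} {T : Finset V} (h : p.coeff T ≠ 0) :
    T ⊆ p.weight.support := fun _ hv =>
  Finsupp.mem_support_iff.2 fun h0 => h (mul_eq_zero_of_left (Finset.prod_eq_zero hv h0) _)

theorem mem_of_coeff_ne_zero {p : Realization K} {T : Finset V} (h : p.coeff T ≠ 0) {v : V}
    (hv : p.threshold < p.weight v) : v ∈ T := by
  classical
  by_contra hvT
  have hpos : 0 < p.threshold - (1 - ∑ v ∈ T, p.weight v) := by
    by_contra! h0
    exact h (mul_eq_zero_of_right _ (max_eq_right h0))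
  have hsum : ∑ u ∈ insert v T, p.weight u ≤ ∑ u ∈ p.weight.support, p.weight u :=
    Finset.sum_le_sum_of_subset_of_nonneg
      (Finset.insert_subset (mem_support_of_threshold_lt hv) (subset_support_of_coeff_ne_zero h))
      fun u _ _ => p.nonneg u
  rw [Finset.sum_insert hvT, sum_weight (Finset.Subset.refl _)] at hsum
  linarith

theorem continuous_coeff_simplexMap (s : K.faces) (T : Finset V) :
    Continuous fun x => (simplexMap K s x).coeff T :=
  (continuous_finsetProd _ fun v _ => continuous_simplexMap_weight s v).mul
    (((continuous_threshold_simplexMap s).sub (continuous_const.sub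
      (continuous_finsetSum _ fun v _ => continuous_simplexMap_weight s v))).max continuous_const)

variable [Nonempty W]

/-- A chosen element to which all members of `T` are related, if there is one. -/
noncomputable def witness (R : V → W → Prop) (T : Finset V) : W :=
  Classical.epsilon fun w => ∀ v ∈ T, R v w

theorem IsDowker.rel_witness (hK : IsDowker R K) {T : Finset V} (hT : T ∈ K.faces) {v : V}
    (hv : v ∈ T) : R v (witness R T) :=
  Classical.epsilon_spec ((hK T).1 hT).2 v hv

/-- The unnormalized weights of the image of `p` under the Dowker map: the witness of each set `T`
of vertices of `p` receives the coefficient of `T`. -/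
noncomputable def dowkerWeight (R : V → W → Prop) (p : Realization K) : W →₀ ℝ :=
  ∑ T ∈ p.weight.support.powerset, Finsupp.single (witness R T) (p.coeff T)

open Classical in
theorem dowkerWeight_apply (p : Realization K) {s : Finset V} (h : p.weight.support ⊆ s) (w : W) :
    dowkerWeight R p w = ∑ T ∈ s.powerset, if witness R T = w then p.coeff T else 0 := by
  rw [dowkerWeight, Finsupp.finsetSum_apply]
  simp only [Finsupp.single_apply]
  refine Finset.sum_subset (Finset.powerset_mono.2 h) fun T _ hT => ?_
  have h0 : p.coeff T = 0 := by
    by_contra h0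
    exact hT (Finset.mem_powerset.2 (subset_support_of_coeff_ne_zero h0))
  rw [h0, ite_self]

theorem dowkerWeight_nonneg (p : Realization K) (w : W) : 0 ≤ dowkerWeight R p w := by
  classical
  rw [dowkerWeight_apply p (Finset.Subset.refl _)]
  refine Finset.sum_nonneg fun T _ => ?_
  split_ifs
  exacts [p.coeff_nonneg T, le_rfl]

theorem exists_of_mem_support_dowkerWeight {p : Realization K} {w : W}
    (hw : w ∈ (dowkerWeight R p).support) : ∃ T, p.coeff T ≠ 0 ∧ witness R T = w := by
  classical
  rw [Finsupp.mem_support_iff, dowkerWeight_apply p (Finset.Subset.refl _)] at hw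
  obtain ⟨T, -, hT⟩ := Finset.exists_ne_zero_of_sum_ne_zero hw
  by_cases h : witness R T = w
  · rw [if_pos h] at hT
    exact ⟨T, hT, h⟩
  · exact absurd (if_neg h) hT

/-- All vertices in the support of the Dowker map at `p` are related to all vertices of `p` whose
weight exceeds the threshold. -/
theorem IsDowker.rel_of_mem_support (hK : IsDowker R K) {p : Realization K} {v : V} {w : W}
    (hv : p.threshold < p.weight v) (hw : w ∈ (dowkerWeight R p).support) : R v w := by
  obtain ⟨T, hT, rfl⟩ := exists_of_mem_support_dowkerWeight hw
  have hvT := mem_of_coeff_ne_zero hT hv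
  exact hK.rel_witness ((K.isRelLowerSet_faces p.support_mem).2
    (subset_support_of_coeff_ne_zero hT) ⟨v, hvT⟩) hvT

theorem support_dowkerWeight_nonempty (R : V → W → Prop) (p : Realization K) :
    (dowkerWeight R p).support.Nonempty := by
  classical
  refine ⟨witness R p.weight.support, Finsupp.mem_support_iff.2 (ne_of_gt ?_)⟩
  rw [dowkerWeight_apply p (Finset.Subset.refl _)]
  refine Finset.sum_pos' (fun T _ => ?_) ⟨p.weight.support, Finset.mem_powerset_self _, ?_⟩
  · split_ifs
    exacts [p.coeff_nonneg T, le_rfl]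
  · rw [if_pos rfl]
    exact p.coeff_support_pos

theorem IsDowker.support_dowkerWeight_mem (hK : IsDowker R K) (hL : IsDowker (flip R) L)
    (p : Realization K) : (dowkerWeight R p).support ∈ L.faces := by
  obtain ⟨v, hv⟩ := p.exists_threshold_lt
  exact (hL _).2 ⟨support_dowkerWeight_nonempty R p, v, fun w hw => hK.rel_of_mem_support hv hw⟩

theorem exists_support_dowkerWeight_subset (R : V → W → Prop)
    (K : PreAbstractSimplicialComplex V) (F : Finset V) :
    ∃ G : Finset W, ∀ p : Realization K, p.weight.support ⊆ F →
      (dowkerWeight R p).support ⊆ G := by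
  classical
  refine ⟨F.powerset.image (witness R), fun p hp w hw => ?_⟩
  obtain ⟨T, hT, rfl⟩ := exists_of_mem_support_dowkerWeight hw
  exact Finset.mem_image_of_mem _
    (Finset.mem_powerset.2 ((subset_support_of_coeff_ne_zero hT).trans hp))

/-- The Dowker map from the Dowker complex of a relation to that of the transposed relation. -/
noncomputable def dowkerMap (hK : IsDowker R K) (hL : IsDowker (flip R) L) :
    C(Realization K, Realization L) where
  toFun p := normalize (dowkerWeight R p) (dowkerWeight_nonneg p)
    (hK.support_dowkerWeight_mem hL p)
  continuous_toFun := continuous_normalize (exists_support_dowkerWeight_subset R K)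
    fun s w => by
      classical
      simp only [fun x => dowkerWeight_apply (R := R) (simplexMap K s x)
        (support_simplexMap_subset s x) w]
      refine continuous_finsetSum _ fun T _ => ?_
      split_ifs
      exacts [continuous_coeff_simplexMap s T, continuous_const]

theorem support_dowkerMap (hK : IsDowker R K) (hL : IsDowker (flip R) L) (p : Realization K) :
    (dowkerMap hK hL p).weight.support = (dowkerWeight R p).support :=
  support_normalize (dowkerWeight R p) (dowkerWeight_nonneg p)
    (hK.support_dowkerWeight_mem hL p)

theorem finitelyCarried_dowkerMap (hK : IsDowker R K) (hL : IsDowker (flip R) L) :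
    FinitelyCarried (dowkerMap hK hL) := by
  intro F
  simp only [support_dowkerMap]
  exact exists_support_dowkerWeight_subset R K F

/-- The Dowker maps of a relation and of its transpose are homotopy inverse to each other. If `w`
is a vertex of `dowkerMap p` whose weight exceeds the threshold there, then `w` is related to all
vertices of `truncate p` and to all vertices of the image of `dowkerMap p`, so that these together
form a simplex. -/
theorem dowkerMap_comp_homotopic_id [Nonempty V] (hK : IsDowker R K) (hL : IsDowker (flip R) L) :
    ((dowkerMap hL hK.flip_flip).comp (dowkerMap hK hL)).Homotopic
      (ContinuousMap.id (Realization K)) := by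
  classical
  refine (homotopic_id_truncate.trans ?_).symm
  refine homotopic_of_union_support_mem finitelyCarried_truncate
    ((finitelyCarried_dowkerMap hL hK.flip_flip).comp (finitelyCarried_dowkerMap hK hL))
    fun p => ?_
  rw [support_truncate, ContinuousMap.comp_apply, support_dowkerMap]
  obtain ⟨w, hw⟩ := (dowkerMap hK hL p).exists_threshold_lt
  refine (hK _).2 ⟨((K.isRelLowerSet_faces p.support_excess_mem).1).mono
    Finset.subset_union_left, w, fun v hv => ?_⟩
  rcases Finset.mem_union.1 hv with hv | hv
  · refine hK.rel_of_mem_support (mem_support_excess.1 hv) ?_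
    rw [← support_dowkerMap hK hL]
    exact mem_support_of_threshold_lt hw
  · exact hL.rel_of_mem_support hw hv

/-- Dowker duality: the Dowker complexes of a relation and of its transpose are homotopy
equivalent. -/
noncomputable def dowkerEquiv [Nonempty V] (hK : IsDowker R K) (hL : IsDowker (flip R) L) :
    ContinuousMap.HomotopyEquiv (Realization K) (Realization L) where
  toFun := dowkerMap hK hL
  invFun := dowkerMap hL hK.flip_flip
  left_inv := dowkerMap_comp_homotopic_id hK hL
  right_inv := dowkerMap_comp_homotopic_id hL hK.flip_flip

/-- Dowker duality is natural up to homotopy in the relation: any vertex of `p` whose weight exceeds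
the threshold is related to the witnesses chosen for either relation. -/
theorem dowkerMap_comp_incl_homotopic (hK : IsDowker R K) (hL : IsDowker (flip R) L)
    (hK' : IsDowker R' K') (hL' : IsDowker (flip R') L') (hR : ∀ v w, R v w → R' v w)
    (hKK' : K ≤ K') (hLL' : L ≤ L') :
    ((dowkerMap hK' hL').comp (incl hKK')).Homotopic ((incl hLL').comp (dowkerMap hK hL)) := by
  classical
  refine homotopic_of_union_support_mem
    ((finitelyCarried_dowkerMap hK' hL').comp (finitelyCarried_incl hKK'))
    ((finitelyCarried_incl hLL').comp (finitelyCarried_dowkerMap hK hL)) fun p => ?_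
  have h : (((incl hLL').comp (dowkerMap hK hL)) p).weight.support
      = (dowkerWeight R p).support := support_dowkerMap hK hL p
  rw [h, ContinuousMap.comp_apply, support_dowkerMap]
  obtain ⟨v, hv⟩ := p.exists_threshold_lt
  refine (hL' _).2 ⟨(support_dowkerWeight_nonempty R p).mono Finset.subset_union_right, v,
    fun w hw => ?_⟩
  rcases Finset.mem_union.1 hw with hw | hw
  · exact hK'.rel_of_mem_support (p := incl hKK' p) hv hw
  · exact hR v w (hK.rel_of_mem_support hv hw)

end Dowker

theorem isEmpty [IsEmpty V] (K : PreAbstractSimplicialComplex V) : IsEmpty (Realization K) :=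
  ⟨fun p => p.exists_threshold_lt.elim fun v _ => isEmptyElim v⟩

end Realization

/-! ### Čech complexes -/

open Realization in
theorem isDowker_cechComplex {M : Type*} [MetricSpace M] (Y X : Set M) (α : ℝ) :
    IsDowker (fun x y => x ∈ X ∧ y ∈ Y ∧ dist x y < α) (cechComplex Y X α) := by
  refine fun σ => ⟨fun ⟨hσ, hX, y, hy, h⟩ => ⟨hσ, y, fun x hx => ⟨hX hx, hy, h x hx⟩⟩,
    fun ⟨hσ, y, h⟩ => ⟨hσ, fun x hx => (h x hx).1, y, ?_, fun x hx => (h x hx).2.2⟩⟩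
  obtain ⟨x, hx⟩ := hσ
  exact (h x hx).2.1

open Realization in
theorem isDowker_flip_cechComplex {M : Type*} [MetricSpace M] (Y X : Set M) (α : ℝ) :
    IsDowker (flip fun x y => x ∈ X ∧ y ∈ Y ∧ dist x y < α) (cechComplex X Y α) := by
  have h : (flip fun x y => x ∈ X ∧ y ∈ Y ∧ dist x y < α) =
      fun y x => y ∈ Y ∧ x ∈ X ∧ dist y x < α := by
    ext y x
    simp only [flip, dist_comm x y]
    exact and_left_comm
  rw [h]
  exact isDowker_cechComplex X Y α

theorem corollary3p2 {M : Type*} [MetricSpace M] (A X : Set M) (hAX : A ⊆ X)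
    (α : ℝ) (hα : 0 < α) :
    ∃ (Γ₁ : ContinuousMap.HomotopyEquiv
          (Realization (cechComplex X A α)) (Realization (cechComplex A X α)))
      (Γ₂ : ContinuousMap.HomotopyEquiv
          (Realization (cechComplex Set.univ A α)) (Realization (cechComplex A Set.univ α)))
      (Γ₃ : ContinuousMap.HomotopyEquiv
          (Realization (cechComplex Set.univ X α)) (Realization (cechComplex X Set.univ α))),
      ContinuousMap.Homotopic
        (Γ₂.toFun.comp
          (Realization.incl (cechComplex_mono (Set.subset_univ X) (Set.Subset.refl A) α)))
        ((Realization.incl (cechComplex_mono (Set.Subset.refl A) (Set.subset_univ X) α)).comp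
          Γ₁.toFun) ∧
      ContinuousMap.Homotopic
        (Γ₃.toFun.comp
          (Realization.incl (cechComplex_mono (Set.Subset.refl Set.univ) hAX α)))
        ((Realization.incl (cechComplex_mono hAX (Set.Subset.refl Set.univ) α)).comp
          Γ₂.toFun) := by
  rcases isEmpty_or_nonempty M with hM | hM
  -- Witnesses are chosen from a nonempty type; if `M` is empty, so are all the realizations.
  · have hE (K : PreAbstractSimplicialComplex M) : IsEmpty (Realization K) :=
      Realization.isEmpty K
    exact ⟨(Homeomorph.empty).toHomotopyEquiv, (Homeomorph.empty).toHomotopyEquiv,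
      (Homeomorph.empty).toHomotopyEquiv,
      ⟨(ContinuousMap.Homotopy.refl _).cast rfl (ContinuousMap.ext fun p => isEmptyElim p)⟩,
      ⟨(ContinuousMap.Homotopy.refl _).cast rfl (ContinuousMap.ext fun p => isEmptyElim p)⟩⟩
  -- Both squares are naturality squares for an enlargement of the relation `dist x y < α`: the left
  -- one enlarges the set of admissible `y` from `X` to `M`, the right one that of admissible `x`
  -- from `A` to `X`.
  · let hK (Y X : Set M) := isDowker_cechComplex Y X α
    let hL (Y X : Set M) := isDowker_flip_cechComplex Y X α
    exact ⟨Realization.dowkerEquiv (hK X A) (hL X A),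
      Realization.dowkerEquiv (hK Set.univ A) (hL Set.univ A),
      Realization.dowkerEquiv (hK Set.univ X) (hL Set.univ X),
      Realization.dowkerMap_comp_incl_homotopic (hK X A) (hL X A) (hK Set.univ A) (hL Set.univ A)
        (fun x y h => ⟨h.1, Set.mem_univ y, h.2.2⟩) _ _,
      Realization.dowkerMap_comp_incl_homotopic (hK Set.univ A) (hL Set.univ A) (hK Set.univ X)
        (hL Set.univ X) (fun x y h => ⟨hAX h.1, h.2⟩) _ _⟩
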